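/- Let $\kappa\neq 0$ and let $M_\kappa^2$ be the complete simply connected surface of constant curvature $\kappa$ (a rescaled hyperbolic plane if $\kappa<0$, a round sphere of radius $\kappa^{-1/2}$ if $\kappa>0$). A triangle is a triple of points $(A,B,C)$ of $M_\kappa^2$ with the minimal geodesics joining them; if $\kappa>0$ the three points are required to lie in a common open hemisphere. It is non-degenerate if no vertex lies on the geodesic segment joining the other two. Its side lengths are $a=|BC|$, $b=|CA|$, $c=|AB|$. Let $D,E,F$ be the midpoints of the sides $BC,CA,AB$. The medial subdivision of $(A,B,C)$ consists of the four labelled triangles $(D,E,F)$ (the innermost one) and $(A,F,E)$, $(F,B,D)$, $(E,D,C)$ (the outer ones at $A$, $B$ and $C$). A sequence of triangles $t_0,t_1,\dots$ is nested if each $t_{n+1}$ is one of the four triangles of the medial subdivision of $t_n$; write $a_n,b_n,c_n$ for the side lengths of $t_n$. The side $a_{n+1}$ is the parallel side of $a_n$ if $t_{n+1}$ is the innermost triangle or the outer triangle at the vertex opposite to $a_n$, i.e. if $a_{n+1}$ joins the midpoints of the two other sides of $t_n$; otherwise $a_{n+1}$ is one half of $a_n$. **Theorem C.** (Hyperbolic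 geometry) Let $\kappa<0$. To each triangle $t_0$ one can associate a constant $l_a=l_a(t_0)>0$ such that for every nested sequence $t_0,t_1,\dots$ starting at $t_0$ and all $n\in\mathbb N$ $$a_0\cdot l_a\le 2^n\cdot a_n\le a_0 .$$ If $t_0$ is non-degenerate and $a_{m+1}$ is the parallel side of $a_m$ for some $m$, then moreover $a_0\cdot l_a<2^n\cdot a_n$ for all $n$ and $2^n\cdot a_n<a_0$ for all $n>m$. For non-degenerate $t_0$ one has $l_a(t_0)<1$, and $l_a(t_0)\to1$ as all the side lengths of $t_0$ tend to $0$. (Spherical geometry) Let $\kappa>0$. To each triangle $t_0$ one can associate a constant $L_a=L_a(t_0)>0$ such that for every nested sequence $t_0,t_1,\dots$ starting at $t_0$ and all $n\in\mathbb N$ $$a_0\le 2^n\cdot a_n\le a_0\cdot L_a .$$ If $t_0$ is non-degenerate and $a_{m+1}$ is the parallel side of $a_m$ for some $m$, then moreover $2^n\cdot a_n<a_0\cdot L_a$ for all $n$ and $a_0<2^n\cdot a_n$ for all $n>m$. For non-degenerate $t_0$ one has $L_a(t_0)>1$, and $L_a(t_0)\to1$ as all the side lengths of $t_0$ tend to $0$.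 The same statements hold for $b_n$ and $c_n$, with constants $l_b,l_c$ and $L_b,L_c$. -/

import Mathlib

namespace MedialSubdivision

/-- Distance of the complete simply connected surface of constant curvature `κ < 0`: the
hyperbolic distance of the upper half-plane (curvature `-1`), rescaled by `|κ|^(-1/2)`. -/
noncomputable def hypDist (κ : ℝ) (z w : UpperHalfPlane) : ℝ :=
  dist z w / Real.sqrt (-κ)

/-- The unit sphere of Euclidean 3-space. -/
abbrev Sphere2 : Type := Metric.sphere (0 : EuclideanSpace ℝ (Fin 3)) 1

/-- Distance of the sphere of constant curvature `κ > 0`: the great-circle (angular) distance of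
the unit sphere, rescaled by `κ^(-1/2)`. -/
noncomputable def sphDist (κ : ℝ) (x y : Sphere2) : ℝ :=
  InnerProductGeometry.angle (x : EuclideanSpace ℝ (Fin 3)) (y : EuclideanSpace ℝ (Fin 3)) /
    Real.sqrt κ

/-- The three vertices lie in a common open hemisphere. -/
def InOpenHemisphere (t : Fin 3 → Sphere2) : Prop :=
  ∃ u : EuclideanSpace ℝ (Fin 3), ∀ i, 0 < inner ℝ u (t i : EuclideanSpace ℝ (Fin 3))

/-- `m` is the midpoint of the minimal geodesic from `x` to `y`, for the distance `d`. -/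
def IsMidpoint {X : Type*} (d : X → X → ℝ) (x y m : X) : Prop :=
  d x m = d x y / 2 ∧ d m y = d x y / 2

/-- Length of the `i`-th side of a labelled triangle, the side opposite to the vertex `t i`. -/
def side {X : Type*} (d : X → X → ℝ) (t : Fin 3 → X) (i : Fin 3) : ℝ :=
  d (t (i + 1)) (t (i + 2))

/-- The triangle is non-degenerate: all triangle inequalities between its sides are strict, that
is, no vertex lies on the geodesic segment joining the other two. -/
def Nondegenerate {X : Type*} (d : X → X → ℝ) (t : Fin 3 → X) : Prop :=
  ∀ i, side d t i < side d t (i + 1) + side d t (i + 2)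

/-- The four triangles of the medial subdivision of a triangle: the innermost one, and the outer
one at each of the three vertices. -/
inductive Piece : Type
  | inner : Piece
  | corner (k : Fin 3) : Piece

/-- `t'` is the piece `p` of the medial subdivision of `t`. The labels are such that the `i`-th
side of `t'` is the half of the `i`-th side of `t` contained in `t'` if there is one, and is
otherwise the segment joining the midpoints of the other two sides of `t`. -/
def IsPieceOf {X : Type*} (d : X → X → ℝ) (p : Piece) (t t' : Fin 3 → X) : Prop :=
  match p with
  | Piece.inner => ∀ i, IsMidpoint d (t (i + 1)) (t (i + 2)) (t' i)
  | Piece.corner k => t' k = t k ∧ ∀ j, j ≠ k → IsMidpoint d (t k) (t j) (t' j)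

/-- Passing to the piece `p` replaces the `i`-th side by its parallel side, the segment joining
the midpoints of the other two sides (rather than by one of its halves). -/
def IsParallelStep (p : Piece) (i : Fin 3) : Prop :=
  p = Piece.inner ∨ p = Piece.corner i

/-- `t 0, t 1, …` is a sequence of nested triangles: `t (n + 1)` is the piece `p n` of the medial
subdivision of `t n`. -/
def IsNested {X : Type*} (d : X → X → ℝ) (p : ℕ → Piece) (t : ℕ → Fin 3 → X) : Prop :=
  ∀ n, IsPieceOf d (p n) (t n) (t (n + 1))

end MedialSubdivision

namespace MedialSubdivision

/-! ### Triangles in a model geometry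

In both geometries the side lengths of the pieces of a triangle are governed by one formula for
the distance to a midpoint, with `C = cosh` in the hyperbolic and `C = cos` in the spherical
case. -/

section Model

variable {X : Type*} {d : X → X → ℝ} {C : ℝ → ℝ}

/-! Write C for cosh or cos. Two uses of the median formula express the parallel side a' through the
half sides: with x = C(a/2), y = C(b/2), z = C(c/2), the half Gram determinant 1 + 2xyz - x² - y² -
z² equals 2yz(x - C(a')). The triangle inequalities make it nonnegative, so a' ≤ a/2 in the
hyperbolic and a' ≥ a/2 in the spherical case, and 2^n a_n is monotone. For strictness the full Gram
determinant is followed: it has the half one as a factor, it is positive for non-degenerate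
triangles, and subdivision keeps it positive (`HasMedianFormula.gramDet_pos`).

For the opposite bound the same formula compares sinh(a/2) with 2 sinh(a'/2), or the sines, up to a
factor √(yz); hence a and 2a' differ by at most a factor exp(const · r²), where r measures the size
of the triangle (`side_dist_le_exp_mul`, `two_mul_side_sphAngle_le`). If r decays geometrically, the
product of these factors converges, and its value gives the constant. In the hyperbolic plane r
halves because sides at least halve. On the sphere it is the diameter of the central projection of
the triangle from the centre of the sphere to a plane, which shrinks by 1/(1+m) when the vertices
have height at least m (`norm_gnomonic_sub_le_of_isPieceOf`). -/

/-- A symmetric function `d` whose medians are given by the (hyperbolic) cosine `C`. -/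
structure HasMedianFormula (d : X → X → ℝ) (C : ℝ → ℝ) : Prop where
  symm : ∀ x y, d x y = d y x
  apply_eq : ∀ s, C s = 2 * C (s / 2) ^ 2 - 1
  median : ∀ {x y m}, IsMidpoint d x y m → ∀ z,
    C (d z x) + C (d z y) = 2 * C (d x y / 2) * C (d z m)

theorem HasMedianFormula.isMidpoint_symm (H : HasMedianFormula d C) {x y m : X}
    (h : IsMidpoint d x y m) : IsMidpoint d y x m :=
  ⟨by rw [H.symm y m, H.symm y x]; exact h.2, by rw [H.symm m x, H.symm y x]; exact h.1⟩

/-- The segment joining the midpoints of two sides. -/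
theorem HasMedianFormula.midline (H : HasMedianFormula d C) {x y z e f : X}
    (hf : IsMidpoint d x y f) (he : IsMidpoint d x z e) :
    2 * C (d x y / 2) * C (d x z / 2) * C (d f e) =
      C (d x y / 2) ^ 2 + C (d x z / 2) ^ 2 + C (d y z / 2) ^ 2 - 1 := by
  -- The median from `e` brings in the distance from `e` to `y`, which is itself a median and is
  -- eliminated by the second formula.
  have h1 := H.median hf e
  have h2 := H.median he y
  rw [H.symm e x, he.1, H.symm e y, H.symm e f] at h1
  rw [H.symm y x, H.apply_eq (d x y), H.apply_eq (d y z)] at h2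
  linear_combination -C (d x z / 2) * h1 - h2 / 2

theorem IsParallelStep.midline (H : HasMedianFormula d C) {p : Piece} {t t' : Fin 3 → X}
    (ht : IsPieceOf d p t t') {i : Fin 3} (hp : IsParallelStep p i) :
    2 * C (side d t (i + 1) / 2) * C (side d t (i + 2) / 2) * C (side d t' i) =
      C (side d t i / 2) ^ 2 + C (side d t (i + 1) / 2) ^ 2 + C (side d t (i + 2) / 2) ^ 2
        - 1 := by
  have e1 : i + 1 + 1 = i + 2 := by fin_cases i <;> rfl
  have e2 : i + 1 + 2 = i := by fin_cases i <;> rfl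
  have e3 : i + 2 + 1 = i := by fin_cases i <;> rfl
  have e4 : i + 2 + 2 = i + 1 := by fin_cases i <;> rfl
  have n1 : i + 1 ≠ i := by fin_cases i <;> decide
  have n2 : i + 2 ≠ i := by fin_cases i <;> decide
  simp only [side, e1, e2, e3, e4]
  rw [H.symm (t (i + 2)) (t i)]
  rcases hp with rfl | rfl
  · have h1 := ht (i + 1)
    have h2 := ht (i + 2)
    rw [e1, e2] at h1
    rw [e3, e4] at h2
    have h := H.midline (H.isMidpoint_symm h1) h2
    rw [H.symm (t (i + 2)) (t (i + 1))] at h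
    linear_combination h
  · have h := H.midline (ht.2 _ n1) (ht.2 _ n2)
    linear_combination h

theorem side_eq_half_of_not_isParallelStep (H : HasMedianFormula d C) {p : Piece}
    {t t' : Fin 3 → X} (ht : IsPieceOf d p t t') {i : Fin 3} (hp : ¬ IsParallelStep p i) :
    side d t' i = side d t i / 2 := by
  cases p with
  | inner => exact absurd (Or.inl rfl) hp
  | corner k =>
    have hk : i ≠ k := fun h => hp (Or.inr (by rw [h]))
    have h12 : i + 1 ≠ i + 2 := by fin_cases i <;> decide
    have hk' : k = i + 1 ∨ k = i + 2 := by
      revert hk; fin_cases i <;> fin_cases k <;> decide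
    rcases hk' with rfl | rfl
    · rw [side, ht.1]
      exact (ht.2 _ h12.symm).1
    · rw [side, ht.1, H.symm, side, H.symm (t (i + 1))]
      exact (ht.2 _ h12).1

/-! ### Gram determinants and non-degeneracy -/

/-- The Gram determinant of the vertices of a triangle, in terms of its sides. -/
def gramDet (d : X → X → ℝ) (C : ℝ → ℝ) (t : Fin 3 → X) : ℝ :=
  1 + 2 * C (side d t 0) * C (side d t 1) * C (side d t 2) - C (side d t 0) ^ 2
    - C (side d t 1) ^ 2 - C (side d t 2) ^ 2

/-- The Gram determinant for the half sides of a triangle, listed starting with the `i`-th. -/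
noncomputable def halfGramDet (d : X → X → ℝ) (C : ℝ → ℝ) (t : Fin 3 → X) (i : Fin 3) : ℝ :=
  1 + 2 * C (side d t i / 2) * C (side d t (i + 1) / 2) * C (side d t (i + 2) / 2)
    - C (side d t i / 2) ^ 2 - C (side d t (i + 1) / 2) ^ 2 - C (side d t (i + 2) / 2) ^ 2

/-- Links the two determinants: the full one behaves well under subdivision, the half one controls
the parallel side. If the half one vanishes, so does the full one. -/
theorem HasMedianFormula.gramDet_eq (H : HasMedianFormula d C) (t : Fin 3 → X) (i : Fin 3) :
    gramDet d C t = 4 * halfGramDet d C t i *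
      (2 * C (side d t i / 2) * C (side d t (i + 1) / 2) * C (side d t (i + 2) / 2)
        + C (side d t i / 2) ^ 2 + C (side d t (i + 1) / 2) ^ 2 + C (side d t (i + 2) / 2) ^ 2
        - 1) := by
  have h0 := H.apply_eq (side d t 0)
  have h1 := H.apply_eq (side d t 1)
  have h2 := H.apply_eq (side d t 2)
  have e1 : (1 : Fin 3) + 1 = 2 := rfl
  have e2 : (1 : Fin 3) + 2 = 0 := rfl
  have e3 : (2 : Fin 3) + 1 = 0 := rfl
  have e4 : (2 : Fin 3) + 2 = 1 := rfl
  rw [gramDet, halfGramDet, h0, h1, h2]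
  fin_cases i <;> simp only [Fin.zero_eta, Fin.mk_one, Fin.reduceFinMk, zero_add, e1, e2, e3, e4]
    <;> ring

theorem HasMedianFormula.halfGramDet_eq (H : HasMedianFormula d C) {p : Piece}
    {t t' : Fin 3 → X} (ht : IsPieceOf d p t t') {i : Fin 3} (hp : IsParallelStep p i) :
    halfGramDet d C t i = 2 * C (side d t (i + 1) / 2) * C (side d t (i + 2) / 2) *
      (C (side d t i / 2) - C (side d t' i)) := by
  rw [halfGramDet]
  linear_combination hp.midline H ht

/-- In the linear model the new vertices are linear combinations of the old ones, so the Gram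
determinant is multiplied by the square of the transition determinant. The factor `c` is the inverse
of that square, cleared of denominators; its nonnegativity is enough, since the product is positive.
-/
theorem HasMedianFormula.gramDet_pos (H : HasMedianFormula d C) {p : Piece}
    {t t' : Fin 3 → X} (ht : IsPieceOf d p t t') (h : 0 < gramDet d C t) :
    0 < gramDet d C t' := by
  obtain ⟨c, hc, hg⟩ : ∃ c : ℝ, 0 ≤ c ∧ c * gramDet d C t' = gramDet d C t := by
    have h0 := H.apply_eq (side d t 0)
    have h1 := H.apply_eq (side d t 1)
    have h2 := H.apply_eq (side d t 2)
    have e1 : (1 : Fin 3) + 1 = 2 := rfl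
    have e2 : (1 : Fin 3) + 2 = 0 := rfl
    have e3 : (2 : Fin 3) + 1 = 0 := rfl
    have e4 : (2 : Fin 3) + 2 = 1 := rfl
    rw [gramDet, gramDet, h0, h1, h2]
    cases p with
    | inner =>
      have m0 := IsParallelStep.midline H ht (i := 0) (Or.inl rfl)
      have m1 := IsParallelStep.midline H ht (i := 1) (Or.inl rfl)
      have m2 := IsParallelStep.midline H ht (i := 2) (Or.inl rfl)
      simp only [zero_add, e1, e2, e3, e4] at m0 m1 m2
      generalize C (side d t 0 / 2) = x, C (side d t 1 / 2) = y, C (side d t 2 / 2) = z at *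
      generalize C (side d t' 0) = x', C (side d t' 1) = y', C (side d t' 2) = z' at *
      refine ⟨16 * x ^ 2 * y ^ 2 * z ^ 2, by positivity, ?_⟩
      have hm : (2 * y * z * x') * (2 * z * x * y') * (2 * x * y * z') =
          (x ^ 2 + y ^ 2 + z ^ 2 - 1) ^ 3 := by rw [m0, m1, m2]; ring
      have q0 : (2 * y * z * x') ^ 2 = (x ^ 2 + y ^ 2 + z ^ 2 - 1) ^ 2 := by rw [m0]
      have q1 : (2 * z * x * y') ^ 2 = (x ^ 2 + y ^ 2 + z ^ 2 - 1) ^ 2 := by rw [m1]; ring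
      have q2 : (2 * x * y * z') ^ 2 = (x ^ 2 + y ^ 2 + z ^ 2 - 1) ^ 2 := by rw [m2]; ring
      linear_combination 4 * hm - 4 * x ^ 2 * q0 - 4 * y ^ 2 * q1 - 4 * z ^ 2 * q2
    | corner k =>
      have m := IsParallelStep.midline H ht (i := k) (Or.inr rfl)
      have hs : ∀ i, i ≠ k → side d t' i = side d t i / 2 := fun i hi =>
        side_eq_half_of_not_isParallelStep H ht
          (by rintro (h | h) <;> simp_all [eq_comm])
      refine ⟨16 * C (side d t (k + 1) / 2) ^ 2 * C (side d t (k + 2) / 2) ^ 2,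
        by positivity, ?_⟩
      have q := congrArg (· ^ 2) m
      fin_cases k <;>
        simp only [Fin.zero_eta, Fin.mk_one, Fin.reduceFinMk, zero_add, e1, e2, e3, e4] at m q hs ⊢
      · rw [hs 1 (by decide), hs 2 (by decide)]
        generalize C (side d t 0 / 2) = x, C (side d t 1 / 2) = y, C (side d t 2 / 2) = z at *
        linear_combination 16 * y ^ 2 * z ^ 2 * m - 4 * q
      · rw [hs 0 (by decide), hs 2 (by decide)]
        generalize C (side d t 0 / 2) = x, C (side d t 1 / 2) = y, C (side d t 2 / 2) = z at *
        linear_combination 16 * x ^ 2 * z ^ 2 * m - 4 * q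
      · rw [hs 0 (by decide), hs 1 (by decide)]
        generalize C (side d t 0 / 2) = x, C (side d t 1 / 2) = y, C (side d t 2 / 2) = z at *
        linear_combination 16 * x ^ 2 * y ^ 2 * m - 4 * q
  by_contra h'
  have := mul_nonpos_of_nonneg_of_nonpos hc (not_lt.1 h')
  linarith

theorem IsNested.gramDet_pos (H : HasMedianFormula d C) {p : ℕ → Piece} {t : ℕ → Fin 3 → X}
    (ht : IsNested d p t) (h : 0 < gramDet d C (t 0)) (n : ℕ) : 0 < gramDet d C (t n) := by
  induction n with
  | zero => exact h
  | succ n ih => exact H.gramDet_pos (ht n) ih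

theorem Nondegenerate.side_pos {t : Fin 3 → X} (ht : Nondegenerate d t) (i : Fin 3) :
    0 < side d t i := by
  have h1 := ht (i + 1)
  have h2 := ht (i + 2)
  have e1 : i + 1 + 1 = i + 2 := by fin_cases i <;> rfl
  have e2 : i + 1 + 2 = i := by fin_cases i <;> rfl
  have e3 : i + 2 + 1 = i := by fin_cases i <;> rfl
  have e4 : i + 2 + 2 = i + 1 := by fin_cases i <;> rfl
  rw [e1, e2] at h1
  rw [e3, e4] at h2
  linarith

/-! ### Rescaling the distance -/

theorem isMidpoint_div {s : ℝ} (hs : s ≠ 0) {x y m : X} :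
    IsMidpoint (fun x y => d x y / s) x y m ↔ IsMidpoint d x y m := by
  simp only [IsMidpoint, div_right_comm _ s, div_left_inj' hs]

theorem isPieceOf_div {s : ℝ} (hs : s ≠ 0) {p : Piece} {t t' : Fin 3 → X} :
    IsPieceOf (fun x y => d x y / s) p t t' ↔ IsPieceOf d p t t' := by
  cases p <;> simp only [IsPieceOf, isMidpoint_div hs]

theorem isNested_div {s : ℝ} (hs : s ≠ 0) {p : ℕ → Piece} {t : ℕ → Fin 3 → X} :
    IsNested (fun x y => d x y / s) p t ↔ IsNested d p t := by
  simp only [IsNested, isPieceOf_div hs]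

theorem nondegenerate_div {s : ℝ} (hs : 0 < s) {t : Fin 3 → X} :
    Nondegenerate (fun x y => d x y / s) t ↔ Nondegenerate d t := by
  simp only [Nondegenerate, side, ← add_div, div_lt_div_iff_of_pos_right hs]

end Model

/-! ### The hyperbolic plane -/

section Hyperbolic

open Real UpperHalfPlane

/-- A null vector of the Lorentzian form `pn - q²` orthogonal to a positive vector vanishes. -/
theorem eq_zero_of_isotropic_of_orthogonal {p q n a b c : ℝ} (hp : 0 < p) (h : p * n - q ^ 2 = 1)
    (h0 : a * c - b ^ 2 = 0) (h1 : a * n + c * p - 2 * b * q = 0) : a = 0 ∧ b = 0 ∧ c = 0 := by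
  have key : (a * n - c * p) ^ 2 + 4 * b ^ 2 = 0 := by
    linear_combination (a * n + c * p + 2 * b * q) * h1 - 4 * b ^ 2 * h
      + (-4 * p * n) * h0
  have hb : b = 0 := by nlinarith [sq_nonneg (a * n - c * p), sq_nonneg b]
  have hac : a * n - c * p = 0 := by
    subst hb
    nlinarith [sq_nonneg (a * n - c * p)]
  subst hb
  have hn : 0 < n := by
    by_contra hn
    nlinarith [sq_nonneg q, mul_nonneg hp.le (sub_nonneg.2 (not_lt.1 hn))]
  have hc : c = 0 := by
    have h2 : c * p = 0 := by linarith
    exact (mul_eq_zero.1 h2).resolve_right hp.ne'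
  have ha : a = 0 := by
    have h2 : a * n = 0 := by rw [hc] at hac; linarith
    exact (mul_eq_zero.1 h2).resolve_right hn.ne'
  exact ⟨ha, rfl, hc⟩

/-- Hyperboloid model: z becomes the symmetric matrix with entries 1/im z, re z/im z, |z|²/im z and
determinant 1, and cosh of the distance is the polarised determinant. -/
theorem cosh_dist_eq_lorentz (z w : ℍ) : cosh (dist z w) =
    (1 / z.im * ((w.re ^ 2 + w.im ^ 2) / w.im) + 1 / w.im * ((z.re ^ 2 + z.im ^ 2) / z.im)
      - 2 * (z.re / z.im) * (w.re / w.im)) / 2 := by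
  have hz := z.im_ne_zero
  have hw := w.im_ne_zero
  rw [cosh_dist']
  field_simp
  ring

theorem cosh_eq_half (s : ℝ) : cosh s = 2 * cosh (s / 2) ^ 2 - 1 := by
  have h := cosh_two_mul (s / 2)
  rw [mul_div_cancel₀ s two_ne_zero] at h
  rw [h, cosh_sq]
  ring

theorem lorentz_self (z : ℍ) :
    1 / z.im * ((z.re ^ 2 + z.im ^ 2) / z.im) - (z.re / z.im) ^ 2 = 1 := by
  have hz := z.im_ne_zero
  field_simp
  ring

theorem hasMedianFormula_dist : HasMedianFormula (dist : ℍ → ℍ → ℝ) cosh where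
  symm := dist_comm
  apply_eq := cosh_eq_half
  median {x y m} hm z := by
    have hx := lorentz_self x
    have hy := lorentz_self y
    have hmm := lorentz_self m
    have h1 := cosh_dist_eq_lorentz x m
    have h2 := cosh_dist_eq_lorentz m y
    have h3 := cosh_dist_eq_lorentz x y
    have hxm := congrArg cosh hm.1
    have hmy := congrArg cosh hm.2
    have hxy := cosh_eq_half (dist x y)
    have hpos : 0 < 1 / m.im := one_div_pos.2 m.im_pos
    rw [hxm] at h1
    rw [hmy] at h2
    rw [hxy] at h3
    rw [cosh_dist_eq_lorentz z x, cosh_dist_eq_lorentz z y, cosh_dist_eq_lorentz z m]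
    clear hxm hmy hxy
    generalize cosh (dist x y / 2) = h at *
    generalize (x.re ^ 2 + x.im ^ 2) / x.im = xn, 1 / x.im = xp, x.re / x.im = xq at *
    generalize (y.re ^ 2 + y.im ^ 2) / y.im = yn, 1 / y.im = yp, y.re / y.im = yq at *
    generalize (z.re ^ 2 + z.im ^ 2) / z.im = zn, 1 / z.im = zp, z.re / z.im = zq at *
    generalize (m.re ^ 2 + m.im ^ 2) / m.im = mn, 1 / m.im = mp, m.re / m.im = mq at *
    -- In the hyperboloid model x + y = 2 cosh(d/2) m: the difference of the two sides is null and
    -- orthogonal to m, hence zero. Pairing with z gives the formula.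
    obtain ⟨ha, hb, hc⟩ := eq_zero_of_isotropic_of_orthogonal
      (a := xp + yp - 2 * h * mp) (b := xq + yq - 2 * h * mq) (c := xn + yn - 2 * h * mn) hpos hmm
      (by linear_combination hx + hy + 4 * h ^ 2 * hmm - 2 * h3 + 4 * h * h1 + 4 * h * h2)
      (by linear_combination -2 * h1 - 2 * h2 - 4 * h * hmm)
    linear_combination (1 / 2) * zn * ha + (1 / 2) * zp * hc - zq * hb

/-! ### One hyperbolic subdivision step -/

theorem side_dist_nonneg (t : Fin 3 → ℍ) (i : Fin 3) : 0 ≤ side dist t i :=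
  dist_nonneg

theorem side_dist_le_add (t : Fin 3 → ℍ) (i : Fin 3) :
    side dist t i ≤ side dist t (i + 1) + side dist t (i + 2) := by
  have e1 : i + 1 + 1 = i + 2 := by fin_cases i <;> rfl
  have e2 : i + 1 + 2 = i := by fin_cases i <;> rfl
  have e3 : i + 2 + 1 = i := by fin_cases i <;> rfl
  have e4 : i + 2 + 2 = i + 1 := by fin_cases i <;> rfl
  simp only [side, e1, e2, e3, e4]
  have h := dist_triangle (t (i + 1)) (t i) (t (i + 2))
  rw [dist_comm (t (i + 1)) (t i), dist_comm (t i) (t (i + 2))] at h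
  linarith

theorem cosh_gram_eq (a b c : ℝ) :
    1 + 2 * cosh a * cosh b * cosh c - cosh a ^ 2 - cosh b ^ 2 - cosh c ^ 2 =
      (cosh a - cosh (b - c)) * (cosh (b + c) - cosh a) := by
  rw [cosh_sub, cosh_add]
  linear_combination (sinh c ^ 2) * cosh_sq b + (cosh b ^ 2 - 1) * cosh_sq c

theorem halfGramDet_cosh_nonneg (t : Fin 3 → ℍ) (i : Fin 3) : 0 ≤ halfGramDet dist cosh t i := by
  have h0 := side_dist_le_add t i
  have h1 := side_dist_le_add t (i + 1)
  have h2 := side_dist_le_add t (i + 2)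
  have e1 : i + 1 + 1 = i + 2 := by fin_cases i <;> rfl
  have e2 : i + 1 + 2 = i := by fin_cases i <;> rfl
  have e3 : i + 2 + 1 = i := by fin_cases i <;> rfl
  have e4 : i + 2 + 2 = i + 1 := by fin_cases i <;> rfl
  rw [e1, e2] at h1
  rw [e3, e4] at h2
  have hi : 0 ≤ side dist t i := dist_nonneg
  rw [halfGramDet, cosh_gram_eq]
  apply mul_nonneg <;> rw [sub_nonneg, cosh_le_cosh]
  · rw [abs_of_nonneg (by linarith : 0 ≤ side dist t i / 2), abs_le]
    constructor <;> linarith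
  · rw [abs_of_nonneg (by linarith : 0 ≤ side dist t i / 2)]
    exact le_trans (by linarith) (le_abs_self _)

theorem Nondegenerate.gramDet_cosh_pos {t : Fin 3 → ℍ} (ht : Nondegenerate dist t) :
    0 < gramDet dist cosh t := by
  have h0 := ht 0
  have h1 := ht 1
  have h2 := ht 2
  have hi := ht.side_pos 0
  have e1 : (1 : Fin 3) + 1 = 2 := rfl
  have e2 : (1 : Fin 3) + 2 = 0 := rfl
  have e3 : (2 : Fin 3) + 1 = 0 := rfl
  have e4 : (2 : Fin 3) + 2 = 1 := rfl
  simp only [zero_add, e1, e2, e3, e4] at h0 h1 h2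
  rw [gramDet, cosh_gram_eq]
  apply mul_pos <;> rw [sub_pos, cosh_lt_cosh]
  · rw [abs_of_pos hi, abs_lt]
    constructor <;> linarith
  · rw [abs_of_pos hi]
    exact lt_of_lt_of_le (by linarith) (le_abs_self _)

/-- A parallel side is at most half as long as the original side. -/
theorem two_mul_side_dist_le {p : Piece} {t t' : Fin 3 → ℍ} (ht : IsPieceOf dist p t t')
    (i : Fin 3) : 2 * side dist t' i ≤ side dist t i := by
  by_cases hp : IsParallelStep p i
  · have h := hasMedianFormula_dist.halfGramDet_eq ht hp
    have h0 := halfGramDet_cosh_nonneg t i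
    rw [h] at h0
    have h1 := nonneg_of_mul_nonneg_right h0 (by positivity)
    rw [sub_nonneg, cosh_le_cosh, abs_of_nonneg (side_dist_nonneg t' i),
      abs_of_nonneg (div_nonneg (side_dist_nonneg t i) zero_le_two)] at h1
    linarith
  · rw [side_eq_half_of_not_isParallelStep hasMedianFormula_dist ht hp]
    linarith

/-- Equality would annihilate the half Gram determinant, and with it the full one. -/
theorem two_mul_side_dist_lt {p : Piece} {t t' : Fin 3 → ℍ} (ht : IsPieceOf dist p t t')
    {i : Fin 3} (hp : IsParallelStep p i) (hg : 0 < gramDet dist cosh t) :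
    2 * side dist t' i < side dist t i := by
  refine (two_mul_side_dist_le ht i).lt_of_ne fun h => hg.ne' ?_
  rw [hasMedianFormula_dist.gramDet_eq t i, hasMedianFormula_dist.halfGramDet_eq ht hp,
    ← h, mul_div_cancel_left₀ _ two_ne_zero, sub_self, mul_zero, mul_zero, zero_mul]

theorem sinh_le_mul_cosh {s : ℝ} (hs : 0 ≤ s) : sinh s ≤ s * cosh s := by
  have hd : ∀ x, HasDerivAt (fun x => x * cosh x - sinh x) (x * sinh x) x := fun x => by
    refine (((hasDerivAt_id' x).fun_mul (hasDerivAt_cosh x)).fun_sub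
      (hasDerivAt_sinh x)).congr_deriv ?_
    ring
  have hm : MonotoneOn (fun x => x * cosh x - sinh x) (Set.Ici 0) := by
    apply monotoneOn_of_deriv_nonneg (convex_Ici 0)
      (fun x _ => (hd x).continuousAt.continuousWithinAt)
      (fun x _ => (hd x).differentiableAt.differentiableWithinAt)
    intro x hx
    rw [interior_Ici, Set.mem_Ioi] at hx
    rw [(hd x).deriv]
    exact mul_nonneg hx.le (sinh_nonneg_iff.2 hx.le)
  have := hm Set.self_mem_Ici (Set.mem_Ici.2 hs) hs
  simp only [zero_mul, sinh_zero, sub_zero] at this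
  linarith

theorem sinh_sq_half (s : ℝ) : 2 * sinh (s / 2) ^ 2 = cosh s - 1 := by
  rw [cosh_eq_half, cosh_sq]
  ring

/-- The midline formula reads 4xy sinh²(a'/2) = sinh²(a/2) + (x - y)², with x, y the hyperbolic
cosines of the other half sides. Dropping the square and using x, y ≤ T = exp(r²/8) gives sinh(a/2)
≤ 2T sinh(a'/2). Replacing sinh by its argument costs one more factor T, whence T² = exp(r²/4). -/
theorem side_dist_le_exp_mul {p : Piece} {t t' : Fin 3 → ℍ} (ht : IsPieceOf dist p t t')
    (i : Fin 3) {r : ℝ} (hr : ∀ j, side dist t j ≤ r) :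
    side dist t i ≤ 2 * side dist t' i * exp (r ^ 2 / 4) := by
  have hr0 : 0 ≤ r := le_trans dist_nonneg (hr 0)
  have ha' : 0 ≤ side dist t' i := dist_nonneg
  by_cases hp : IsParallelStep p i
  · have hle := two_mul_side_dist_le ht i
    have hcosh : ∀ s, 0 ≤ s → s ≤ r → cosh (s / 2) ≤ exp (r ^ 2 / 8) := fun s h0 h1 =>
      (cosh_le_exp_half_sq _).trans (exp_le_exp.2 (by nlinarith))
    have hx := hcosh _ (side_dist_nonneg t (i + 1)) (hr _)
    have hy := hcosh _ (side_dist_nonneg t (i + 2)) (hr _)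
    have hz := hcosh _ ha' (by linarith [hr i])
    have hT : exp (r ^ 2 / 4) = exp (r ^ 2 / 8) * exp (r ^ 2 / 8) := by
      rw [← exp_add]; ring_nf
    have hmid := hp.midline hasMedianFormula_dist ht
    have hs' := sinh_sq_half (side dist t' i)
    have hs : cosh (side dist t i / 2) ^ 2 = sinh (side dist t i / 2) ^ 2 + 1 := cosh_sq _
    have hx1 := cosh_pos (side dist t (i + 1) / 2)
    have hy1 := cosh_pos (side dist t (i + 2) / 2)
    have h1 : side dist t i / 2 ≤ sinh (side dist t i / 2) :=
      self_le_sinh_iff.2 (div_nonneg dist_nonneg zero_le_two)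
    have h2 := sinh_le_mul_cosh (div_nonneg ha' zero_le_two)
    have h3 : 0 ≤ sinh (side dist t' i / 2) := sinh_nonneg_iff.2 (div_nonneg ha' zero_le_two)
    rw [hT]
    generalize exp (r ^ 2 / 8) = T at *
    generalize cosh (side dist t (i + 1) / 2) = x, cosh (side dist t (i + 2) / 2) = y at *
    have hT0 : 0 < T := hx1.trans_le hx
    have h4 : sinh (side dist t i / 2) ≤ 2 * T * sinh (side dist t' i / 2) := by
      apply le_of_sq_le_sq _ (by positivity)
      have hxy : x * y ≤ T * T := mul_le_mul hx hy hy1.le hT0.le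
      have := mul_le_mul_of_nonneg_right hxy (sq_nonneg (sinh (side dist t' i / 2)))
      nlinarith [sq_nonneg (x - y)]
    have h5 : side dist t' i / 2 * cosh (side dist t' i / 2) ≤ side dist t' i / 2 * T := by
      gcongr
    have h6 : 2 * T * sinh (side dist t' i / 2) ≤ 2 * T * (side dist t' i / 2 * T) := by
      gcongr
      exact h2.trans h5
    linarith
  · rw [side_eq_half_of_not_isParallelStep hasMedianFormula_dist ht hp,
      mul_div_cancel₀ _ two_ne_zero]
    exact le_mul_of_one_le_right dist_nonneg (one_le_exp (by positivity))

/-! ### Iteration in the hyperbolic plane -/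

/-- The constant of the hyperbolic estimate. -/
noncomputable def hypConst (t : Fin 3 → ℍ) : ℝ :=
  exp (-((∑ j, side dist t j) ^ 2 / 3))

theorem IsNested.antitone_side_dist {p : ℕ → Piece} {t : ℕ → Fin 3 → ℍ}
    (ht : IsNested dist p t) (i : Fin 3) : Antitone fun n => 2 ^ n * side dist (t n) i :=
  antitone_nat_of_succ_le fun n => by
    have := mul_le_mul_of_nonneg_left (two_mul_side_dist_le (ht n) i)
      (by positivity : (0 : ℝ) ≤ 2 ^ n)
    rwa [← mul_assoc, ← pow_succ] at this

/-- The exponential weight makes the induction telescope: r²/3 = r²/4 + (r/2)²/3, where r²/4 is the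
loss in one step and r halves. What is left of the weight at stage n gives strictness. -/
theorem IsNested.le_side_dist {p : ℕ → Piece} {t : ℕ → Fin 3 → ℍ}
    (ht : IsNested dist p t) (i : Fin 3) (n : ℕ) :
    side dist (t 0) i * hypConst (t 0) ≤ 2 ^ n * side dist (t n) i *
      exp (-(((∑ j, side dist (t 0) j) / 2 ^ n) ^ 2 / 3)) := by
  induction n with
  | zero => simp [hypConst]
  | succ n ih =>
    refine ih.trans ?_
    have hside : ∀ j, side dist (t n) j ≤ (∑ j, side dist (t 0) j) / 2 ^ n := fun j => by
      rw [le_div_iff₀ (by positivity), mul_comm]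
      have h1 := ht.antitone_side_dist j (Nat.zero_le n)
      simp only [pow_zero, one_mul] at h1
      exact h1.trans (Finset.single_le_sum (f := fun j => side dist (t 0) j)
        (fun _ _ => dist_nonneg) (Finset.mem_univ j))
    have h := side_dist_le_exp_mul (ht n) i hside
    rw [pow_succ (2 : ℝ) n, ← div_div]
    generalize (∑ j, side dist (t 0) j) / 2 ^ n = r at *
    have hexp : exp (-((r / 2) ^ 2 / 3)) = exp (r ^ 2 / 4) * exp (-(r ^ 2 / 3)) := by
      rw [← exp_add]; ring_nf
    rw [hexp]
    calc 2 ^ n * side dist (t n) i * exp (-(r ^ 2 / 3))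
        ≤ 2 ^ n * (2 * side dist (t (n + 1)) i * exp (r ^ 2 / 4)) * exp (-(r ^ 2 / 3)) := by
          gcongr
      _ = _ := by ring

theorem hyperbolic_estimate {p : ℕ → Piece} {t : ℕ → Fin 3 → ℍ} (ht : IsNested dist p t)
    (i : Fin 3) (n : ℕ) : side dist (t 0) i * hypConst (t 0) ≤ 2 ^ n * side dist (t n) i ∧
      2 ^ n * side dist (t n) i ≤ side dist (t 0) i := by
  refine ⟨(ht.le_side_dist i n).trans (mul_le_of_le_one_right
    (mul_nonneg (by positivity) dist_nonneg) (exp_le_one_iff.2 ?_)), ?_⟩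
  · rw [neg_nonpos]
    positivity
  · simpa using ht.antitone_side_dist i (Nat.zero_le n)

theorem Nondegenerate.sum_side_pos {X : Type*} {d : X → X → ℝ} {t : Fin 3 → X}
    (ht : Nondegenerate d t) : 0 < ∑ j, side d t j :=
  Finset.sum_pos (fun j _ => ht.side_pos j) Finset.univ_nonempty

theorem hyperbolic_estimate_left_strict {p : ℕ → Piece} {t : ℕ → Fin 3 → ℍ}
    (ht : IsNested dist p t) (h0 : Nondegenerate dist (t 0)) (i : Fin 3) (n : ℕ) :
    side dist (t 0) i * hypConst (t 0) < 2 ^ n * side dist (t n) i := by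
  have h1 := ht.le_side_dist i n
  have h2 : 0 < side dist (t 0) i * hypConst (t 0) := mul_pos (h0.side_pos i) (exp_pos _)
  have h3 : 0 < 2 ^ n * side dist (t n) i :=
    h2.trans_le (hyperbolic_estimate ht i n).1
  have h4 := h0.sum_side_pos
  refine h1.trans_lt (mul_lt_of_lt_one_right h3 (exp_lt_one_iff.2 ?_))
  rw [neg_lt_zero]
  positivity

theorem hyperbolic_estimate_right_strict {p : ℕ → Piece} {t : ℕ → Fin 3 → ℍ}
    (ht : IsNested dist p t) (h0 : Nondegenerate dist (t 0)) {i : Fin 3} {m n : ℕ}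
    (hp : IsParallelStep (p m) i) (hmn : m < n) :
    2 ^ n * side dist (t n) i < side dist (t 0) i := by
  have h1 := ht.antitone_side_dist i (Nat.succ_le_of_lt hmn)
  have h2 := (hyperbolic_estimate ht i m).2
  have h3 := two_mul_side_dist_lt (ht m) hp
    (ht.gramDet_pos hasMedianFormula_dist h0.gramDet_cosh_pos m)
  have h4 := mul_lt_mul_of_pos_left h3 (by positivity : (0 : ℝ) < 2 ^ m)
  simp only [Nat.succ_eq_add_one, pow_succ] at h1
  linarith

theorem hypConst_lt_one {t : Fin 3 → ℍ} (ht : Nondegenerate dist t) : hypConst t < 1 := by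
  have h := ht.sum_side_pos
  refine exp_lt_one_iff.2 ?_
  rw [neg_lt_zero]
  positivity

theorem exists_lt_hypConst {ε : ℝ} (hε : 0 < ε) :
    ∃ δ > 0, ∀ t : Fin 3 → ℍ, (∀ j, side dist t j < δ) → 1 - ε < hypConst t := by
  -- With sides below δ ≤ 1 the exponent is at most 3δ² ≤ 3δ ≤ 3ε/4.
  refine ⟨min 1 (ε / 4), by positivity, fun t ht => ?_⟩
  have h0 : 0 ≤ ∑ j, side dist t j := Finset.sum_nonneg fun _ _ => dist_nonneg
  have h1 : ∑ j, side dist t j ≤ 3 * min 1 (ε / 4) := by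
    have := Finset.sum_le_card_nsmul Finset.univ (side dist t) _ fun j _ => (ht j).le
    simpa using this
  have h2 : (∑ j, side dist t j) ^ 2 / 3 < ε := by
    have h3 : (0 : ℝ) < min 1 (ε / 4) := by positivity
    have h4 := min_le_left 1 (ε / 4)
    have h5 := min_le_right 1 (ε / 4)
    nlinarith
  have := add_one_le_exp (-((∑ j, side dist t j) ^ 2 / 3))
  rw [hypConst]
  linarith

end Hyperbolic

/-! ### The sphere -/

section Spherical

open Real InnerProductGeometry

local notation "E3" => EuclideanSpace ℝ (Fin 3)

/-- The angular distance on the unit sphere. -/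
noncomputable def sphAngle (x y : Sphere2) : ℝ := angle (x : E3) (y : E3)

theorem sphAngle_nonneg (x y : Sphere2) : 0 ≤ sphAngle x y := angle_nonneg _ _

theorem sphAngle_le_pi (x y : Sphere2) : sphAngle x y ≤ π := angle_le_pi _ _

theorem sphAngle_comm (x y : Sphere2) : sphAngle x y = sphAngle y x := angle_comm _ _

theorem norm_sphere (x : Sphere2) : ‖(x : E3)‖ = 1 := by
  simp

theorem inner_self_sphere (x : Sphere2) : inner ℝ (x : E3) x = 1 := by
  rw [real_inner_self_eq_norm_sq, norm_sphere, one_pow]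

theorem inner_le_one {u : E3} (hu : ‖u‖ = 1) (x : Sphere2) : inner ℝ u (x : E3) ≤ 1 := by
  simpa [hu, norm_sphere] using real_inner_le_norm u (x : E3)

theorem cos_sphAngle (x y : Sphere2) : cos (sphAngle x y) = inner ℝ (x : E3) y := by
  rw [sphAngle, cos_angle, norm_sphere, norm_sphere, mul_one, div_one]

theorem cos_eq_half (s : ℝ) : cos s = 2 * cos (s / 2) ^ 2 - 1 := by
  rw [← cos_two_mul, mul_div_cancel₀ s two_ne_zero]

/-- The difference of the two sides has squared norm zero, all the inner products involved being
cosines known from the hypothesis. -/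
theorem IsMidpoint.add_eq {x y m : Sphere2} (h : IsMidpoint sphAngle x y m) :
    (x : E3) + y = (2 * cos (sphAngle x y / 2)) • (m : E3) := by
  have h1 := cos_sphAngle x m
  have h2 := cos_sphAngle m y
  have h3 := cos_sphAngle x y
  rw [h.1] at h1
  rw [h.2] at h2
  rw [cos_eq_half] at h3
  rw [← sub_eq_zero, ← inner_self_eq_zero (𝕜 := ℝ)]
  simp only [inner_sub_left, inner_sub_right, inner_add_left, inner_add_right, inner_smul_left,
    inner_smul_right, conj_trivial, inner_self_sphere, real_inner_comm (x : E3) (m : E3),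
    real_inner_comm (m : E3) (y : E3), real_inner_comm (x : E3) (y : E3)]
  rw [← h1, ← h2, ← h3]
  ring

theorem hasMedianFormula_sphAngle : HasMedianFormula sphAngle cos where
  symm := sphAngle_comm
  apply_eq := cos_eq_half
  median {x y m} hm z := by
    rw [cos_sphAngle, cos_sphAngle, cos_sphAngle, ← inner_add_right, hm.add_eq, inner_smul_right]

theorem side_sphAngle_le_add (t : Fin 3 → Sphere2) (i : Fin 3) :
    side sphAngle t i ≤ side sphAngle t (i + 1) + side sphAngle t (i + 2) := by
  have e1 : i + 1 + 1 = i + 2 := by fin_cases i <;> rfl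
  have e2 : i + 1 + 2 = i := by fin_cases i <;> rfl
  have e3 : i + 2 + 1 = i := by fin_cases i <;> rfl
  have e4 : i + 2 + 2 = i + 1 := by fin_cases i <;> rfl
  simp only [side, e1, e2, e3, e4]
  have h : sphAngle (t (i + 1)) (t (i + 2)) ≤
      sphAngle (t (i + 1)) (t i) + sphAngle (t i) (t (i + 2)) := angle_le_angle_add_angle _ _ _
  rw [sphAngle_comm (t (i + 1)) (t i), sphAngle_comm (t i) (t (i + 2))] at h
  linarith

theorem cos_gram_eq (a b c : ℝ) :
    1 + 2 * cos a * cos b * cos c - cos a ^ 2 - cos b ^ 2 - cos c ^ 2 =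
      (cos a - cos (b + c)) * (cos (b - c) - cos a) := by
  rw [cos_sub, cos_add]
  linear_combination (-sin c ^ 2) * sin_sq_add_cos_sq b + (cos b ^ 2 - 1) * sin_sq_add_cos_sq c

/-- Half sides are at most π/2, so two of them add up to at most π and cos is decreasing on the
relevant range; no bound on the perimeter is needed here, unlike for the full Gram determinant. -/
theorem halfGramDet_cos_nonneg (t : Fin 3 → Sphere2) (i : Fin 3) :
    0 ≤ halfGramDet sphAngle cos t i := by
  have h0 := side_sphAngle_le_add t i
  have h1 := side_sphAngle_le_add t (i + 1)
  have h2 := side_sphAngle_le_add t (i + 2)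
  have e1 : i + 1 + 1 = i + 2 := by fin_cases i <;> rfl
  have e2 : i + 1 + 2 = i := by fin_cases i <;> rfl
  have e3 : i + 2 + 1 = i := by fin_cases i <;> rfl
  have e4 : i + 2 + 2 = i + 1 := by fin_cases i <;> rfl
  rw [e1, e2] at h1
  rw [e3, e4] at h2
  have hi : side sphAngle t i ≤ π := sphAngle_le_pi _ _
  have hj : side sphAngle t (i + 1) ≤ π := sphAngle_le_pi _ _
  have hk : side sphAngle t (i + 2) ≤ π := sphAngle_le_pi _ _
  have hi' : 0 ≤ side sphAngle t i := sphAngle_nonneg _ _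
  have := pi_pos
  rw [halfGramDet, cos_gram_eq]
  apply mul_nonneg <;> rw [sub_nonneg]
  · exact cos_le_cos_of_nonneg_of_le_pi (by linarith) (by linarith) (by linarith)
  · rw [← cos_abs (_ - _)]
    exact cos_le_cos_of_nonneg_of_le_pi (abs_nonneg _) (by linarith)
      (abs_le.2 ⟨by linarith, by linarith⟩)

/-- All vertices of `t` have height at least `m` over the plane orthogonal to `u`. -/
def InCap (u : E3) (m : ℝ) (t : Fin 3 → Sphere2) : Prop :=
  ∀ i, m ≤ inner ℝ u (t i : E3)

theorem InOpenHemisphere.exists_inCap {t : Fin 3 → Sphere2} (h : InOpenHemisphere t) :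
    ∃ u : E3, ‖u‖ = 1 ∧ ∃ m > 0, InCap u m t := by
  obtain ⟨u, hu⟩ := h
  have hu0 : 0 < ‖u‖ := by
    rw [norm_pos_iff]
    rintro rfl
    simpa using hu 0
  obtain ⟨k, -, hk⟩ := Finset.exists_min_image Finset.univ
    (fun i => inner ℝ (‖u‖⁻¹ • u) (t i : E3)) Finset.univ_nonempty
  refine ⟨‖u‖⁻¹ • u, ?_, _, ?_, fun i => hk i (Finset.mem_univ i)⟩
  · rw [norm_smul, norm_inv, norm_norm, inv_mul_cancel₀ hu0.ne']
  · rw [real_inner_smul_left]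
    exact mul_pos (inv_pos.2 hu0) (hu k)

theorem norm_add_sq_sphere (x y : Sphere2) :
    ‖(x : E3) + y‖ ^ 2 = 4 * cos (sphAngle x y / 2) ^ 2 := by
  rw [norm_add_sq_real, norm_sphere, norm_sphere, ← cos_sphAngle, cos_eq_half]
  ring

theorem norm_sub_sq_sphere (x y : Sphere2) :
    ‖(x : E3) - y‖ ^ 2 = 2 - 2 * cos (sphAngle x y) := by
  rw [norm_sub_sq_real, norm_sphere, norm_sphere, ← cos_sphAngle]
  ring

theorem cos_half_sphAngle_nonneg (x y : Sphere2) : 0 ≤ cos (sphAngle x y / 2) :=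
  cos_nonneg_of_neg_pi_div_two_le_of_le (by linarith [sphAngle_nonneg x y, pi_pos])
    (by linarith [sphAngle_le_pi x y])

/-- The vector x + y has norm 2 cos(d/2) and height at least 2m. -/
theorem le_cos_half_sphAngle {u : E3} (hu : ‖u‖ = 1) {m : ℝ} (hm : 0 < m) {x y : Sphere2}
    (hx : m ≤ inner ℝ u (x : E3)) (hy : m ≤ inner ℝ u (y : E3)) :
    m ≤ cos (sphAngle x y / 2) := by
  have h1 := real_inner_le_norm u ((x : E3) + y)
  rw [hu, one_mul, inner_add_right] at h1
  have h2 := norm_add_sq_sphere x y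
  refine le_of_sq_le_sq ?_ (cos_half_sphAngle_nonneg x y)
  nlinarith

theorem sphAngle_lt_pi_of_cos_half_pos {x y : Sphere2} (h : 0 < cos (sphAngle x y / 2)) :
    sphAngle x y < π := by
  refine (sphAngle_le_pi x y).lt_of_ne fun h' => ?_
  rw [h', cos_pi_div_two] at h
  exact h.false

/-- The perimeter of a triangle in an open hemisphere is less than that of a great circle. -/
theorem InOpenHemisphere.perimeter_lt {t : Fin 3 → Sphere2} (h : InOpenHemisphere t) :
    side sphAngle t 0 + side sphAngle t 1 + side sphAngle t 2 < 2 * π := by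
  obtain ⟨u, hu, m, hm, hcap⟩ := h.exists_inCap
  have hpi : ∀ i, side sphAngle t i < π := fun i => sphAngle_lt_pi_of_cos_half_pos
    (hm.trans_le (le_cos_half_sphAngle hu hm (hcap _) (hcap _)))
  have s0 : side sphAngle t 0 = sphAngle (t 1) (t 2) := rfl
  have s1 : side sphAngle t 1 = sphAngle (t 2) (t 0) := rfl
  have s2 : side sphAngle t 2 = sphAngle (t 0) (t 1) := rfl
  have h0 := hpi 0
  have h1 := hpi 1
  have h2 := hpi 2
  have hle : side sphAngle t 0 + side sphAngle t 1 + side sphAngle t 2 ≤ 2 * π := by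
    -- Triangle inequality through the antipode of `t 0`.
    have := angle_le_angle_add_angle (t 1 : E3) (-(t 0 : E3)) (t 2)
    rw [angle_neg_right, angle_neg_left, angle_comm (t 1 : E3) (t 0), angle_comm (t 0 : E3) (t 2)]
      at this
    rw [s0, s1, s2]
    simp only [sphAngle]
    linarith
  refine hle.lt_of_ne fun heq => ?_
  have c0 := cos_sphAngle (t 1) (t 2)
  have c1 := cos_sphAngle (t 2) (t 0)
  have c2 := cos_sphAngle (t 0) (t 1)
  rw [← s0] at c0
  rw [← s1] at c1
  rw [← s2] at c2
  generalize side sphAngle t 0 = a, side sphAngle t 1 = b, side sphAngle t 2 = c at *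
  have hc : c = 2 * π - (a + b) := by linarith
  -- If the perimeter were 2π, the vertices would satisfy this linear relation with positive
  -- coefficients, which is impossible for vectors of positive height over `u`.
  have hv : sin a • (t 0 : E3) + sin b • (t 1 : E3) + sin c • (t 2 : E3) = 0 := by
    rw [← inner_self_eq_zero (𝕜 := ℝ)]
    simp only [inner_add_left, inner_add_right, inner_smul_left,
      inner_smul_right, conj_trivial, inner_self_sphere, real_inner_comm (t 0 : E3) (t 1 : E3),
      real_inner_comm (t 1 : E3) (t 2 : E3), real_inner_comm (t 2 : E3) (t 0 : E3)]
    rw [← c0, ← c1, ← c2, hc, sin_two_pi_sub, cos_two_pi_sub, sin_add, cos_add]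
    linear_combination -sin a ^ 2 * sin_sq_add_cos_sq b - sin b ^ 2 * sin_sq_add_cos_sq a
  have hu' := congrArg (inner ℝ u) hv
  simp only [inner_add_right, inner_smul_right, inner_zero_right] at hu'
  have p0 := mul_pos (sin_pos_of_pos_of_lt_pi (by linarith) h0) (hm.trans_le (hcap 0))
  have p1 := mul_pos (sin_pos_of_pos_of_lt_pi (by linarith) h1) (hm.trans_le (hcap 1))
  have p2 := mul_pos (sin_pos_of_pos_of_lt_pi (by linarith) h2) (hm.trans_le (hcap 2))
  linarith

theorem Nondegenerate.gramDet_cos_pos {t : Fin 3 → Sphere2} (ht : Nondegenerate sphAngle t)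
    (h : InOpenHemisphere t) : 0 < gramDet sphAngle cos t := by
  have h0 := ht 0
  have h1 := ht 1
  have h2 := ht 2
  have p0 := ht.side_pos 0
  have p1 := ht.side_pos 1
  have p2 := ht.side_pos 2
  have hp := h.perimeter_lt
  have hi : side sphAngle t 0 ≤ π := sphAngle_le_pi _ _
  have e1 : (1 : Fin 3) + 1 = 2 := rfl
  have e2 : (1 : Fin 3) + 2 = 0 := rfl
  have e3 : (2 : Fin 3) + 1 = 0 := rfl
  have e4 : (2 : Fin 3) + 2 = 1 := rfl
  simp only [zero_add, e1, e2, e3, e4] at h0 h1 h2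
  rw [gramDet, cos_gram_eq]
  apply mul_pos <;> rw [sub_pos]
  · rcases le_total (side sphAngle t 1 + side sphAngle t 2) π with hle | hle
    -- Up to π the triangle inequality decides; beyond π the sum is reflected to 2π minus itself,
    -- and the perimeter bound takes over.
    · exact cos_lt_cos_of_nonneg_of_le_pi p0.le hle h0
    · rw [← cos_two_pi_sub]
      exact cos_lt_cos_of_nonneg_of_le_pi p0.le (by linarith) (by linarith)
  · rw [← cos_abs (_ - _)]
    exact cos_lt_cos_of_nonneg_of_le_pi (abs_nonneg _) hi
      (abs_lt.2 ⟨by linarith, by linarith⟩)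

/-! ### Central projection of a cap to a plane -/

/-- The midpoint is (x + y)/2 divided by cos(d/2) ≤ 1, so its height is at least the mean height. -/
theorem le_inner_of_isMidpoint {u : E3} (hu : ‖u‖ = 1) {m : ℝ} (hm : 0 < m) {x y z : Sphere2}
    (hx : m ≤ inner ℝ u (x : E3)) (hy : m ≤ inner ℝ u (y : E3)) (hz : IsMidpoint sphAngle x y z) :
    m ≤ inner ℝ u (z : E3) := by
  have h1 := congrArg (inner ℝ u) hz.add_eq
  rw [inner_add_right, inner_smul_right] at h1
  have h2 := le_cos_half_sphAngle hu hm hx hy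
  have h3 := cos_le_one (sphAngle x y / 2)
  by_contra! h
  nlinarith

/-- The projection from the origin to the plane of points `p` with `⟪u, p⟫ = 1`. -/
noncomputable def gnomonic (u : E3) (x : Sphere2) : E3 := (inner ℝ u (x : E3))⁻¹ • (x : E3)

/-- `z` is `x` or the midpoint of `x` and `y`. -/
def IsStartOrMidpoint (x y z : Sphere2) : Prop := z = x ∨ IsMidpoint sphAngle x y z

/-- The projection sends the midpoint to a point of the projected segment, not to its midpoint: with
heights a of x and b of y the ratio is s = b/(a + b). As b ≤ 1 and a ≥ m, this is at most 1/(1 + m).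
-/
theorem IsStartOrMidpoint.exists_gnomonic_eq {u : E3} (hu : ‖u‖ = 1) {m : ℝ} (hm : 0 < m)
    {x y z : Sphere2} (hx : m ≤ inner ℝ u (x : E3)) (hy : m ≤ inner ℝ u (y : E3))
    (hz : IsStartOrMidpoint x y z) : ∃ s : ℝ, 0 ≤ s ∧ s ≤ 1 / (1 + m) ∧
      gnomonic u z = gnomonic u x + s • (gnomonic u y - gnomonic u x) := by
  rcases hz with rfl | hz
  · exact ⟨0, le_rfl, by positivity, by simp⟩
  have h1 := congrArg (inner ℝ u) hz.add_eq
  rw [inner_add_right, inner_smul_right] at h1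
  have h2 := hm.trans_le (le_cos_half_sphAngle hu hm hx hy)
  have hy1 := inner_le_one hu y
  have h3 : (z : E3) = (2 * cos (sphAngle x y / 2))⁻¹ • ((x : E3) + y) := by
    rw [hz.add_eq, smul_smul, inv_mul_cancel₀ (by positivity), one_smul]
  have hz0 := hm.trans_le (le_inner_of_isMidpoint hu hm hx hy hz)
  have hx0 := hm.trans_le hx
  have hy0 := hm.trans_le hy
  rw [gnomonic, gnomonic, gnomonic]
  generalize inner ℝ u (x : E3) = a, inner ℝ u (y : E3) = b, inner ℝ u (z : E3) = c,
    cos (sphAngle x y / 2) = h at *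
  refine ⟨b / (a + b), by positivity, ?_, ?_⟩
  · rw [div_le_div_iff₀ (by positivity) (by positivity)]
    nlinarith
  · rw [h3, smul_smul, ← mul_inv, mul_comm c, ← h1, smul_sub, smul_smul, smul_smul, smul_add]
    have ea : (a + b)⁻¹ = a⁻¹ - b / (a + b) * a⁻¹ := by field_simp; ring
    have eb : (a + b)⁻¹ = b / (a + b) * b⁻¹ := by field_simp
    have : (a + b)⁻¹ • (x : E3) = a⁻¹ • (x : E3) - (b / (a + b) * a⁻¹) • (x : E3) := by
      rw [← sub_smul, ← ea]
    rw [this, ← eb]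
    abel

theorem norm_sub_le_of_homothetic {V : Type*} [NormedAddCommGroup V] [NormedSpace ℝ V]
    {x y z : V} {s s' q r : ℝ} (hs : 0 ≤ s) (hs' : 0 ≤ s') (hq : s ≤ q) (hq' : s' ≤ q)
    (hy : ‖y - x‖ ≤ r) (hz : ‖z - x‖ ≤ r) (hyz : ‖y - z‖ ≤ r) :
    ‖(x + s • (y - x)) - (x + s' • (z - x))‖ ≤ q * r := by
  have hr : 0 ≤ r := (norm_nonneg _).trans hy
  rcases le_total s' s with h | h
  -- Homothety by the smaller ratio, followed by a move along one side; the coefficients add up to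
  -- the larger ratio.
  · have : (x + s • (y - x)) - (x + s' • (z - x)) = (s - s') • (y - x) + s' • (y - z) := by
      module
    rw [this]
    refine (norm_add_le _ _).trans ?_
    rw [norm_smul, norm_smul, norm_of_nonneg hs', norm_of_nonneg (sub_nonneg.2 h)]
    nlinarith [mul_le_mul_of_nonneg_left hy (sub_nonneg.2 h), mul_le_mul_of_nonneg_left hyz hs',
      mul_le_mul_of_nonneg_right hq hr]
  · have : (x + s • (y - x)) - (x + s' • (z - x)) = s • (y - z) - (s' - s) • (z - x) := by
      module
    rw [this]
    refine (norm_sub_le _ _).trans ?_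
    rw [norm_smul, norm_smul, norm_of_nonneg hs, norm_of_nonneg (sub_nonneg.2 h)]
    nlinarith [mul_le_mul_of_nonneg_left hz (sub_nonneg.2 h), mul_le_mul_of_nonneg_left hyz hs,
      mul_le_mul_of_nonneg_right hq' hr]

/-- Any two vertices of a piece lie on sides issuing from a common vertex `t k`, as the comparison
of two homotheties with the same centre requires. -/
theorem IsPieceOf.exists_isStartOrMidpoint {p : Piece} {t t' : Fin 3 → Sphere2}
    (ht : IsPieceOf sphAngle p t t') (i j : Fin 3) : ∃ k a b,
      IsStartOrMidpoint (t k) (t a) (t' i) ∧ IsStartOrMidpoint (t k) (t b) (t' j) := by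
  cases p with
  | inner =>
    have key : ∀ i k : Fin 3, k ≠ i → ∃ a, IsStartOrMidpoint (t k) (t a) (t' i) := by
      intro i k hk
      have hk' : k = i + 1 ∨ k = i + 2 := by
        revert hk; fin_cases i <;> fin_cases k <;> decide
      rcases hk' with rfl | rfl
      · exact ⟨_, Or.inr (ht i)⟩
      · exact ⟨_, Or.inr (hasMedianFormula_sphAngle.isMidpoint_symm (ht i))⟩
    obtain ⟨k, hi, hj⟩ : ∃ k : Fin 3, k ≠ i ∧ k ≠ j := by
      revert i j; decide
    obtain ⟨a, ha⟩ := key i k hi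
    obtain ⟨b, hb⟩ := key j k hj
    exact ⟨k, a, b, ha, hb⟩
  | corner k =>
    have key : ∀ i : Fin 3, IsStartOrMidpoint (t k) (t i) (t' i) := by
      intro i
      by_cases hi : i = k
      · subst hi
        exact Or.inl ht.1
      · exact Or.inr (ht.2 i hi)
    exact ⟨k, i, j, key i, key j⟩

theorem InCap.of_isPieceOf {u : E3} (hu : ‖u‖ = 1) {m : ℝ} (hm : 0 < m) {p : Piece}
    {t t' : Fin 3 → Sphere2} (ht : IsPieceOf sphAngle p t t') (h : InCap u m t) :
    InCap u m t' := fun i => by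
  obtain ⟨k, a, -, hi, -⟩ := ht.exists_isStartOrMidpoint i i
  rcases hi with hi | hi
  · rw [hi]
    exact h k
  · exact le_inner_of_isMidpoint hu hm (h k) (h a) hi

theorem norm_gnomonic_sub_le_of_isPieceOf {u : E3} (hu : ‖u‖ = 1) {m : ℝ} (hm : 0 < m) {p : Piece}
    {t t' : Fin 3 → Sphere2} (ht : IsPieceOf sphAngle p t t') (h : InCap u m t) {r : ℝ}
    (hr : ∀ i j, ‖gnomonic u (t i) - gnomonic u (t j)‖ ≤ r) (i j : Fin 3) :
    ‖gnomonic u (t' i) - gnomonic u (t' j)‖ ≤ r / (1 + m) := by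
  obtain ⟨k, a, b, hi, hj⟩ := ht.exists_isStartOrMidpoint i j
  obtain ⟨s, h0, h1, hs⟩ := hi.exists_gnomonic_eq hu hm (h k) (h a)
  obtain ⟨s', h0', h1', hs'⟩ := hj.exists_gnomonic_eq hu hm (h k) (h b)
  rw [hs, hs', div_eq_mul_one_div, mul_comm]
  exact norm_sub_le_of_homothetic h0 h0' h1 h1' (hr _ _) (hr _ _) (hr _ _)

/-! ### One spherical subdivision step -/

theorem side_sphAngle_nonneg (t : Fin 3 → Sphere2) (i : Fin 3) : 0 ≤ side sphAngle t i :=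
  sphAngle_nonneg _ _

theorem side_sphAngle_le_pi (t : Fin 3 → Sphere2) (i : Fin 3) : side sphAngle t i ≤ π :=
  sphAngle_le_pi _ _

theorem norm_gnomonic_sub_sq (u : E3) (x y : Sphere2) :
    ‖gnomonic u x - gnomonic u y‖ ^ 2 = (inner ℝ u (x : E3))⁻¹ ^ 2 + (inner ℝ u (y : E3))⁻¹ ^ 2
      - 2 * ((inner ℝ u (x : E3))⁻¹ * (inner ℝ u (y : E3))⁻¹) * cos (sphAngle x y) := by
  rw [norm_sub_sq_real, gnomonic, gnomonic, norm_smul, norm_smul, norm_sphere, norm_sphere,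
    mul_one, mul_one, norm_eq_abs, norm_eq_abs, sq_abs, sq_abs, real_inner_smul_left,
    real_inner_smul_right, cos_sphAngle]
  ring

/-- Inverse heights are at least 1, so projecting does not decrease chords, and c² ≥ 1 - r²/4 for c
= cos(d/2). Since also c ≥ m, one gets c² exp(r²/(4m²)) ≥ c² + r²/4 ≥ 1. -/
theorem one_le_cos_half_mul_exp {u : E3} (hu : ‖u‖ = 1) {m : ℝ} (hm : 0 < m) {x y : Sphere2}
    (hx : m ≤ inner ℝ u (x : E3)) (hy : m ≤ inner ℝ u (y : E3)) {r : ℝ}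
    (hr : ‖gnomonic u x - gnomonic u y‖ ≤ r) :
    1 ≤ cos (sphAngle x y / 2) * exp (r ^ 2 / (8 * m ^ 2)) := by
  have h1 := le_cos_half_sphAngle hu hm hx hy
  have h2 := norm_gnomonic_sub_sq u x y
  have h3 := cos_eq_half (sphAngle x y)
  have hc := cos_le_one (sphAngle x y)
  have ha := one_le_inv_iff₀.2 ⟨hm.trans_le hx, inner_le_one hu x⟩
  have hb := one_le_inv_iff₀.2 ⟨hm.trans_le hy, inner_le_one hu y⟩
  have h4 : ‖gnomonic u x - gnomonic u y‖ ^ 2 ≤ r ^ 2 := by gcongr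
  have h5 : 1 - r ^ 2 / 4 ≤ cos (sphAngle x y / 2) ^ 2 := by
    generalize (inner ℝ u (x : E3))⁻¹ = a, (inner ℝ u (y : E3))⁻¹ = b at *
    have hab : 1 ≤ a * b := one_le_mul_of_one_le_of_one_le ha hb
    nlinarith [sq_nonneg (a - b), mul_nonneg (sub_nonneg.2 hab) (sub_nonneg.2 hc)]
  have h6 : exp (r ^ 2 / (8 * m ^ 2)) ^ 2 = exp (r ^ 2 / (4 * m ^ 2)) := by
    rw [← exp_nat_mul]
    congr 1
    push_cast
    field_simp
    ring
  have h7 := add_one_le_exp (r ^ 2 / (4 * m ^ 2))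
  have h8 : 0 ≤ cos (sphAngle x y / 2) := hm.le.trans h1
  refine le_of_sq_le_sq ?_ (by positivity)
  rw [mul_pow, h6, one_pow]
  generalize cos (sphAngle x y / 2) = c at *
  have h9 : r ^ 2 / 4 ≤ c ^ 2 * (r ^ 2 / (4 * m ^ 2)) := by
    rw [mul_div_assoc', div_le_div_iff₀ (by norm_num) (by positivity)]
    have : m ^ 2 ≤ c ^ 2 := by gcongr
    nlinarith [mul_le_mul_of_nonneg_left this (sq_nonneg r)]
  nlinarith [mul_le_mul_of_nonneg_left h7 (sq_nonneg c)]

/-- A parallel side is at least half as long as the original side. -/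
theorem side_sphAngle_le_two_mul {u : E3} (hu : ‖u‖ = 1) {m : ℝ} (hm : 0 < m) {p : Piece}
    {t t' : Fin 3 → Sphere2} (ht : IsPieceOf sphAngle p t t') (h : InCap u m t) (i : Fin 3) :
    side sphAngle t i ≤ 2 * side sphAngle t' i := by
  by_cases hp : IsParallelStep p i
  · have h1 := hasMedianFormula_sphAngle.halfGramDet_eq ht hp
    have h0 := halfGramDet_cos_nonneg t i
    have hx : 0 < cos (side sphAngle t (i + 1) / 2) :=
      hm.trans_le (le_cos_half_sphAngle hu hm (h _) (h _))
    have hy : 0 < cos (side sphAngle t (i + 2) / 2) :=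
      hm.trans_le (le_cos_half_sphAngle hu hm (h _) (h _))
    rw [h1] at h0
    have h2 := nonneg_of_mul_nonneg_right h0 (by positivity)
    by_contra! h3
    have h4 := cos_lt_cos_of_nonneg_of_le_pi (side_sphAngle_nonneg t' i)
      (by linarith [side_sphAngle_le_pi t i, pi_pos])
      (by linarith : side sphAngle t' i < side sphAngle t i / 2)
    linarith
  · rw [side_eq_half_of_not_isParallelStep hasMedianFormula_sphAngle ht hp]
    linarith

theorem side_sphAngle_lt_two_mul {u : E3} (hu : ‖u‖ = 1) {m : ℝ} (hm : 0 < m) {p : Piece}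
    {t t' : Fin 3 → Sphere2} (ht : IsPieceOf sphAngle p t t') (h : InCap u m t) {i : Fin 3}
    (hp : IsParallelStep p i) (hg : 0 < gramDet sphAngle cos t) :
    side sphAngle t i < 2 * side sphAngle t' i := by
  refine (side_sphAngle_le_two_mul hu hm ht h i).lt_of_ne fun h => hg.ne' ?_
  rw [hasMedianFormula_sphAngle.gramDet_eq t i, hasMedianFormula_sphAngle.halfGramDet_eq ht hp,
    h, mul_div_cancel_left₀ _ two_ne_zero, sub_self, mul_zero, mul_zero, zero_mul]

/-- Here 4xy sin²(a'/2) = sin²(a/2) - (x - y)², with x, y the cosines of the other half sides. With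
T = exp(r²/(8m²)) and xT, yT ≥ 1 this gives 2 sin(a'/2) ≤ T sin(a/2); passing from sin(a'/2) to a'/2
costs another T. -/
theorem two_mul_side_sphAngle_le {u : E3} (hu : ‖u‖ = 1) {m : ℝ} (hm : 0 < m) {p : Piece}
    {t t' : Fin 3 → Sphere2} (ht : IsPieceOf sphAngle p t t') (h : InCap u m t) {r : ℝ}
    (hr : ∀ i j, ‖gnomonic u (t i) - gnomonic u (t j)‖ ≤ r) (i : Fin 3) :
    2 * side sphAngle t' i ≤ side sphAngle t i * exp (r ^ 2 / (4 * m ^ 2)) := by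
  have ha' := side_sphAngle_nonneg t' i
  have ha := side_sphAngle_nonneg t i
  have hr0 : 0 ≤ r := (norm_nonneg _).trans (hr 0 0)
  by_cases hp : IsParallelStep p i
  · have h' := h.of_isPieceOf hu hm ht
    have hr' : ∀ i j, ‖gnomonic u (t' i) - gnomonic u (t' j)‖ ≤ r := fun i j =>
      (norm_gnomonic_sub_le_of_isPieceOf hu hm ht h hr i j).trans
        (div_le_self hr0 (by linarith))
    have hx : 1 ≤ cos (side sphAngle t (i + 1) / 2) * exp (r ^ 2 / (8 * m ^ 2)) :=
      one_le_cos_half_mul_exp hu hm (h _) (h _) (hr _ _)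
    have hy : 1 ≤ cos (side sphAngle t (i + 2) / 2) * exp (r ^ 2 / (8 * m ^ 2)) :=
      one_le_cos_half_mul_exp hu hm (h _) (h _) (hr _ _)
    have hz : 1 ≤ cos (side sphAngle t' i / 2) * exp (r ^ 2 / (8 * m ^ 2)) :=
      one_le_cos_half_mul_exp hu hm (h' _) (h' _) (hr' _ _)
    have hpos : 0 < cos (side sphAngle t' i / 2) :=
      hm.trans_le (le_cos_half_sphAngle hu hm (h' _) (h' _))
    have hlt : side sphAngle t' i < π := sphAngle_lt_pi_of_cos_half_pos hpos
    have hT : exp (r ^ 2 / (4 * m ^ 2)) =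
        exp (r ^ 2 / (8 * m ^ 2)) * exp (r ^ 2 / (8 * m ^ 2)) := by
      rw [← exp_add]
      congr 1
      field_simp
      ring
    have hmid := hp.midline hasMedianFormula_sphAngle ht
    have hc' := cos_eq_half (side sphAngle t' i)
    have hs' := sin_sq_add_cos_sq (side sphAngle t' i / 2)
    have hs := sin_sq_add_cos_sq (side sphAngle t i / 2)
    have h1 : sin (side sphAngle t i / 2) ≤ side sphAngle t i / 2 := sin_le (by positivity)
    have h2 : side sphAngle t' i / 2 * cos (side sphAngle t' i / 2) ≤
        sin (side sphAngle t' i / 2) := by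
      rw [← le_div_iff₀ hpos, ← tan_eq_sin_div_cos]
      exact le_tan (by positivity) (by linarith)
    have h3 : 0 ≤ sin (side sphAngle t i / 2) :=
      sin_nonneg_of_nonneg_of_le_pi (by positivity)
        (by linarith [side_sphAngle_le_pi t i, pi_pos])
    have hT0 := exp_pos (r ^ 2 / (8 * m ^ 2))
    rw [hT]
    generalize exp (r ^ 2 / (8 * m ^ 2)) = T at *
    generalize cos (side sphAngle t (i + 1) / 2) = x, cos (side sphAngle t (i + 2) / 2) = y at *
    have h4 : 2 * sin (side sphAngle t' i / 2) ≤ T * sin (side sphAngle t i / 2) := by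
      apply le_of_sq_le_sq _ (by positivity)
      have hxy : 1 ≤ (x * T) * (y * T) := one_le_mul_of_one_le_of_one_le hx hy
      have h5 := mul_le_mul_of_nonneg_right hxy (sq_nonneg (2 * sin (side sphAngle t' i / 2)))
      have h6 : x * y * (2 * sin (side sphAngle t' i / 2)) ^ 2 ≤
          sin (side sphAngle t i / 2) ^ 2 := by
        nlinarith [sq_nonneg (x - y)]
      nlinarith [mul_le_mul_of_nonneg_left h6 (sq_nonneg T)]
    have h5 := mul_le_mul_of_nonneg_left hz ha'
    have h6 := mul_le_mul_of_nonneg_left h2 hT0.le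
    have h7 := mul_le_mul_of_nonneg_left h4 hT0.le
    have h8 := mul_le_mul_of_nonneg_left h1 (mul_pos hT0 hT0).le
    linarith
  · rw [side_eq_half_of_not_isParallelStep hasMedianFormula_sphAngle ht hp,
      mul_div_cancel₀ _ two_ne_zero]
    exact le_mul_of_one_le_right ha (one_le_exp (by positivity))

/-! ### Iteration on the sphere -/

/-- The constant of the spherical estimate for a triangle in a cap of height at least `m` whose
central projection has diameter at most `r`. -/
noncomputable def capConst (m r : ℝ) : ℝ :=
  exp ((1 + m) ^ 2 / (4 * m ^ 3 * (m + 2)) * r ^ 2)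

/-- The exponent is the geometric series of the one-step losses r²/(4m²) with r divided by 1 + m
each time; splitting off the first term makes the induction telescope. -/
theorem capConst_eq {m : ℝ} (hm : 0 < m) (r : ℝ) :
    capConst m r = exp (r ^ 2 / (4 * m ^ 2)) * capConst m (r / (1 + m)) := by
  rw [capConst, capConst, ← exp_add]
  congr 1
  field_simp
  ring

theorem one_le_capConst {m : ℝ} (hm : 0 < m) (r : ℝ) : 1 ≤ capConst m r :=
  one_le_exp (by positivity)

theorem one_lt_capConst {m r : ℝ} (hm : 0 < m) (hr : 0 < r) : 1 < capConst m r :=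
  one_lt_exp_iff.2 (by positivity)

/-- The central projection of `t` along `u` is defined with height at least `m`, and has diameter
at most `r`. -/
structure CapBound (u : E3) (m r : ℝ) (t : Fin 3 → Sphere2) : Prop where
  norm_eq : ‖u‖ = 1
  pos : 0 < m
  inCap : InCap u m t
  dist_le : ∀ i j, ‖gnomonic u (t i) - gnomonic u (t j)‖ ≤ r

section Nested

variable {u : E3} {m r : ℝ} {p : ℕ → Piece} {t : ℕ → Fin 3 → Sphere2}

theorem CapBound.of_isNested (ht : IsNested sphAngle p t) (h : CapBound u m r (t 0)) (n : ℕ) :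
    CapBound u m (r / (1 + m) ^ n) (t n) := by
  induction n with
  | zero => simpa using h
  | succ n ih =>
    refine ⟨h.norm_eq, h.pos, ih.inCap.of_isPieceOf h.norm_eq h.pos (ht n), ?_⟩
    rw [pow_succ, ← div_div]
    exact norm_gnomonic_sub_le_of_isPieceOf h.norm_eq h.pos (ht n) ih.inCap ih.dist_le

theorem CapBound.monotone_side (ht : IsNested sphAngle p t) (h : CapBound u m r (t 0))
    (i : Fin 3) : Monotone fun n => 2 ^ n * side sphAngle (t n) i :=
  monotone_nat_of_le_succ fun n => by
    have := mul_le_mul_of_nonneg_left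
      (side_sphAngle_le_two_mul h.norm_eq h.pos (ht n) (h.of_isNested ht n).inCap i)
      (by positivity : (0 : ℝ) ≤ 2 ^ n)
    rwa [← mul_assoc, ← pow_succ] at this

theorem CapBound.side_mul_capConst_le (ht : IsNested sphAngle p t) (h : CapBound u m r (t 0))
    (i : Fin 3) (n : ℕ) : 2 ^ n * side sphAngle (t n) i * capConst m (r / (1 + m) ^ n) ≤
      side sphAngle (t 0) i * capConst m r := by
  induction n with
  | zero => simp
  | succ n ih =>
    refine le_trans ?_ ih
    have hn := h.of_isNested ht n
    have hs := two_mul_side_sphAngle_le h.norm_eq h.pos (ht n) hn.inCap hn.dist_le i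
    rw [pow_succ (1 + m) n, ← div_div, capConst_eq h.pos (r / (1 + m) ^ n)]
    have hpos : 0 ≤ capConst m (r / (1 + m) ^ n / (1 + m)) := (exp_pos _).le
    calc 2 ^ (n + 1) * side sphAngle (t (n + 1)) i * capConst m (r / (1 + m) ^ n / (1 + m))
        = 2 ^ n * (2 * side sphAngle (t (n + 1)) i) * capConst m (r / (1 + m) ^ n / (1 + m)) := by
          ring
      _ ≤ 2 ^ n * (side sphAngle (t n) i * exp ((r / (1 + m) ^ n) ^ 2 / (4 * m ^ 2))) *
            capConst m (r / (1 + m) ^ n / (1 + m)) := by gcongr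
      _ = _ := by ring

theorem CapBound.estimate (ht : IsNested sphAngle p t) (h : CapBound u m r (t 0))
    (i : Fin 3) (n : ℕ) : side sphAngle (t 0) i ≤ 2 ^ n * side sphAngle (t n) i ∧
      2 ^ n * side sphAngle (t n) i ≤ side sphAngle (t 0) i * capConst m r := by
  refine ⟨by simpa using h.monotone_side ht i (Nat.zero_le n),
    le_trans (le_mul_of_one_le_right ?_ (one_le_capConst h.pos _))
      (h.side_mul_capConst_le ht i n)⟩
  exact mul_nonneg (by positivity) (side_sphAngle_nonneg _ _)

theorem CapBound.estimate_right_strict (ht : IsNested sphAngle p t) (h : CapBound u m r (t 0))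
    (h0 : Nondegenerate sphAngle (t 0)) (hr : 0 < r) (i : Fin 3) (n : ℕ) :
    2 ^ n * side sphAngle (t n) i < side sphAngle (t 0) i * capConst m r := by
  have hm := h.pos
  refine lt_of_lt_of_le (lt_mul_of_one_lt_right ?_ (one_lt_capConst hm (by positivity)))
    (h.side_mul_capConst_le ht i n)
  exact (h0.side_pos i).trans_le (h.estimate ht i n).1

theorem CapBound.estimate_left_strict (ht : IsNested sphAngle p t) (h : CapBound u m r (t 0))
    (hh : InOpenHemisphere (t 0)) (h0 : Nondegenerate sphAngle (t 0)) {i : Fin 3} {k n : ℕ}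
    (hp : IsParallelStep (p k) i) (hkn : k < n) :
    side sphAngle (t 0) i < 2 ^ n * side sphAngle (t n) i := by
  have h1 := h.monotone_side ht i (Nat.succ_le_of_lt hkn)
  have h2 := (h.estimate ht i k).1
  have h3 := side_sphAngle_lt_two_mul h.norm_eq h.pos (ht k) (h.of_isNested ht k).inCap hp
    (ht.gramDet_pos hasMedianFormula_sphAngle (h0.gramDet_cos_pos hh) k)
  have h4 := mul_lt_mul_of_pos_left h3 (by positivity : (0 : ℝ) < 2 ^ k)
  simp only [Nat.succ_eq_add_one, pow_succ] at h1
  linarith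

end Nested

/-! ### Explicit bounds for small spherical triangles -/

theorem norm_sub_le_sphAngle (x y : Sphere2) : ‖(x : E3) - y‖ ≤ sphAngle x y := by
  refine le_of_sq_le_sq ?_ (sphAngle_nonneg x y)
  rw [norm_sub_sq_sphere]
  linarith [one_sub_sq_div_two_le_cos (x := sphAngle x y)]

theorem norm_gnomonic_sub_le {u : E3} (hu : ‖u‖ = 1) {x y : Sphere2}
    (hx : 1 / 2 ≤ inner ℝ u (x : E3)) (hy : 1 / 2 ≤ inner ℝ u (y : E3)) :
    ‖gnomonic u x - gnomonic u y‖ ≤ 6 * sphAngle x y := by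
  refine le_trans ?_ (mul_le_mul_of_nonneg_left (norm_sub_le_sphAngle x y) (by norm_num))
  have ha : (inner ℝ u (x : E3))⁻¹ ≤ 2 := inv_le_of_inv_le₀ (by norm_num) (by linarith)
  have hb : (inner ℝ u (y : E3))⁻¹ ≤ 2 := inv_le_of_inv_le₀ (by norm_num) (by linarith)
  have ha0 : 0 < inner ℝ u (x : E3) := by linarith
  have hb0 : 0 < inner ℝ u (y : E3) := by linarith
  -- Inverse heights are at most 2, so the two terms contribute 2 and 2 · 2 times the chord, whence
  -- the factor 6.
  have h1 : gnomonic u x - gnomonic u y = (inner ℝ u (x : E3))⁻¹ • ((x : E3) - y) -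
      ((inner ℝ u (x : E3))⁻¹ * (inner ℝ u (y : E3))⁻¹ * inner ℝ u ((x : E3) - y)) • (y : E3) := by
    have h2 : (inner ℝ u (x : E3))⁻¹ * (inner ℝ u (y : E3))⁻¹ * inner ℝ u ((x : E3) - y) =
        (inner ℝ u (y : E3))⁻¹ - (inner ℝ u (x : E3))⁻¹ := by
      rw [inner_sub_right]
      field_simp
    rw [h2, gnomonic, gnomonic]
    module
  have h3 : |inner ℝ u ((x : E3) - y)| ≤ ‖(x : E3) - y‖ := by
    simpa [hu] using abs_real_inner_le_norm u ((x : E3) - y)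
  rw [h1]
  refine (norm_sub_le _ _).trans ?_
  rw [norm_smul, norm_smul, norm_sphere, mul_one, norm_eq_abs, norm_eq_abs, abs_mul, abs_mul,
    abs_of_pos (inv_pos.2 ha0), abs_of_pos (inv_pos.2 hb0)]
  calc _ ≤ 2 * ‖(x : E3) - y‖ + 2 * 2 * ‖(x : E3) - y‖ := by gcongr
    _ = _ := by ring

theorem sphAngle_self (x : Sphere2) : sphAngle x x = 0 :=
  angle_self (by rw [← norm_ne_zero_iff, norm_sphere]; exact one_ne_zero)

theorem sphAngle_eq_zero_or_side (t : Fin 3 → Sphere2) (i j : Fin 3) :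
    sphAngle (t i) (t j) = 0 ∨ ∃ k, sphAngle (t i) (t j) = side sphAngle t k := by
  by_cases h : i = j
  · exact Or.inl (by rw [h, sphAngle_self])
  · right
    have hk : ∃ k : Fin 3, (i = k + 1 ∧ j = k + 2) ∨ (i = k + 2 ∧ j = k + 1) := by
      revert i j; decide
    obtain ⟨k, ⟨rfl, rfl⟩ | ⟨rfl, rfl⟩⟩ := hk
    · exact ⟨k, rfl⟩
    · exact ⟨k, sphAngle_comm _ _⟩

/-- The vertex `t 0` itself serves as axis, and cos(π/3) = 1/2 is the height. A fixed height is what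
makes the constant tend to 1 with the sides. -/
theorem capBound_of_side_lt {t : Fin 3 → Sphere2} (h : ∀ j, side sphAngle t j < π / 3) :
    CapBound (t 0) (1 / 2) (6 * ∑ j, side sphAngle t j) t := by
  have hcap : InCap (t 0) (1 / 2) t := fun i => by
    rw [← cos_sphAngle, ← cos_pi_div_three]
    refine cos_le_cos_of_nonneg_of_le_pi (sphAngle_nonneg _ _) (by linarith [pi_pos]) ?_
    rcases sphAngle_eq_zero_or_side t 0 i with h0 | ⟨k, hk⟩
    · rw [h0]; positivity
    · rw [hk]; exact (h k).le
  refine ⟨norm_sphere _, by norm_num, hcap, fun i j =>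
    (norm_gnomonic_sub_le (norm_sphere _) (hcap i) (hcap j)).trans ?_⟩
  gcongr
  rcases sphAngle_eq_zero_or_side t i j with h0 | ⟨k, hk⟩
  · rw [h0]; exact Finset.sum_nonneg fun j _ => side_sphAngle_nonneg t j
  · rw [hk]
    exact Finset.single_le_sum (f := side sphAngle t) (fun j _ => side_sphAngle_nonneg t j)
      (Finset.mem_univ k)

theorem InOpenHemisphere.exists_capBound {t : Fin 3 → Sphere2} (h : InOpenHemisphere t) :
    ∃ u m r, 0 < r ∧ CapBound u m r t := by
  obtain ⟨u, hu, m, hm, hcap⟩ := h.exists_inCap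
  obtain ⟨r, hr⟩ := (Set.finite_range fun k : Fin 3 × Fin 3 =>
    ‖gnomonic u (t k.1) - gnomonic u (t k.2)‖).bddAbove
  exact ⟨u, m, max r 1, by positivity, hu, hm, hcap, fun i j =>
    (hr (Set.mem_range_self (i, j))).trans (le_max_left _ _)⟩

/-- A height and a diameter bounding a central projection of `t`, explicit for small `t`. -/
theorem exists_capBound_explicit (t : Fin 3 → Sphere2) : ∃ m r, InOpenHemisphere t →
    (∃ u, CapBound u m r t) ∧ (Nondegenerate sphAngle t → 0 < r) ∧
      ((∀ j, side sphAngle t j < π / 3) → m = 1 / 2 ∧ r = 6 * ∑ j, side sphAngle t j) := by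
  by_cases hs : ∀ j, side sphAngle t j < π / 3
  · refine ⟨_, _, fun _ => ⟨⟨_, capBound_of_side_lt hs⟩, fun h => ?_, fun _ => ⟨rfl, rfl⟩⟩⟩
    have := h.sum_side_pos
    positivity
  · by_cases h : InOpenHemisphere t
    · obtain ⟨u, m, r, hr, hb⟩ := h.exists_capBound
      exact ⟨m, r, fun _ => ⟨⟨u, hb⟩, fun _ => hr, fun h' => absurd h' hs⟩⟩
    -- Junk values outside open hemispheres; `capConst` is an exponential, so it is still positive
    -- there.
    · exact ⟨0, 0, fun h' => absurd h' h⟩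

theorem exists_capConst_lt {ε : ℝ} (hε : 0 < ε) : ∃ δ > 0, δ ≤ π / 3 ∧ ∀ t : Fin 3 → Sphere2,
    (∀ j, side sphAngle t j < δ) → capConst (1 / 2) (6 * ∑ j, side sphAngle t j) < 1 + ε := by
  have hcont : Continuous fun s => capConst (1 / 2) (6 * s) := by
    unfold capConst
    fun_prop
  have h0 : capConst (1 / 2) (6 * 0) < 1 + ε := by simpa [capConst] using hε
  obtain ⟨δ, hδ, h⟩ := Metric.eventually_nhds_iff.1
    (hcont.continuousAt.eventually_lt_const h0)
  refine ⟨min (δ / 4) (π / 3), by positivity, min_le_right _ _, fun t ht => h ?_⟩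
  have h1 : ∑ j, side sphAngle t j ≤ 3 * (δ / 4) := by
    have := Finset.sum_le_card_nsmul Finset.univ (side sphAngle t) _
      fun j _ => (ht j).le.trans (min_le_left _ _)
    simpa using this
  rw [dist_zero_right, norm_of_nonneg (Finset.sum_nonneg fun j _ => side_sphAngle_nonneg t j)]
  linarith

end Spherical

end MedialSubdivision

/-! ### Assembly for arbitrary curvature -/

open MedialSubdivision in
theorem theoremC :
    -- hyperbolic geometry
    (∀ κ : ℝ, κ < 0 → ∃ l : (Fin 3 → UpperHalfPlane) → Fin 3 → ℝ,
      (∀ t₀ i, 0 < l t₀ i) ∧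
      (∀ (p : ℕ → Piece) (t : ℕ → Fin 3 → UpperHalfPlane), IsNested (hypDist κ) p t →
        ∀ i : Fin 3,
          (∀ n : ℕ,
            side (hypDist κ) (t 0) i * l (t 0) i ≤ 2 ^ n * side (hypDist κ) (t n) i ∧
            2 ^ n * side (hypDist κ) (t n) i ≤ side (hypDist κ) (t 0) i) ∧
          (Nondegenerate (hypDist κ) (t 0) → ∀ m : ℕ, IsParallelStep (p m) i →
            (∀ n : ℕ,
              side (hypDist κ) (t 0) i * l (t 0) i < 2 ^ n * side (hypDist κ) (t n) i) ∧
            (∀ n : ℕ, m < n →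
              2 ^ n * side (hypDist κ) (t n) i < side (hypDist κ) (t 0) i))) ∧
      (∀ t₀, Nondegenerate (hypDist κ) t₀ → ∀ i, l t₀ i < 1) ∧
      (∀ ε : ℝ, 0 < ε → ∃ δ : ℝ, 0 < δ ∧ ∀ t₀, Nondegenerate (hypDist κ) t₀ →
        (∀ j, side (hypDist κ) t₀ j < δ) → ∀ i, 1 - ε < l t₀ i)) ∧
    -- spherical geometry
    (∀ κ : ℝ, 0 < κ → ∃ L : (Fin 3 → Sphere2) → Fin 3 → ℝ,
      (∀ t₀ i, 0 < L t₀ i) ∧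
      (∀ (p : ℕ → Piece) (t : ℕ → Fin 3 → Sphere2), InOpenHemisphere (t 0) →
        IsNested (sphDist κ) p t →
        ∀ i : Fin 3,
          (∀ n : ℕ,
            side (sphDist κ) (t 0) i ≤ 2 ^ n * side (sphDist κ) (t n) i ∧
            2 ^ n * side (sphDist κ) (t n) i ≤ side (sphDist κ) (t 0) i * L (t 0) i) ∧
          (Nondegenerate (sphDist κ) (t 0) → ∀ m : ℕ, IsParallelStep (p m) i →
            (∀ n : ℕ, m < n →
              side (sphDist κ) (t 0) i < 2 ^ n * side (sphDist κ) (t n) i) ∧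
            (∀ n : ℕ,
              2 ^ n * side (sphDist κ) (t n) i < side (sphDist κ) (t 0) i * L (t 0) i))) ∧
      (∀ t₀, InOpenHemisphere t₀ → Nondegenerate (sphDist κ) t₀ → ∀ i, 1 < L t₀ i) ∧
      (∀ ε : ℝ, 0 < ε → ∃ δ : ℝ, 0 < δ ∧ ∀ t₀, InOpenHemisphere t₀ →
        Nondegenerate (sphDist κ) t₀ →
        (∀ j, side (sphDist κ) t₀ j < δ) → ∀ i, L t₀ i < 1 + ε)) := by
  constructor
  · intro κ hκ
    have hs : 0 < Real.sqrt (-κ) := Real.sqrt_pos.2 (neg_pos.2 hκ)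
    have hd : hypDist κ = fun z w => dist z w / Real.sqrt (-κ) := rfl
    have hside : ∀ t i, side (hypDist κ) t i = side dist t i / Real.sqrt (-κ) := fun _ _ => rfl
    -- One constant serves all three sides and every curvature: the estimates are homogeneous in the
    -- distance, so the scale cancels and only δ has to be rescaled.
    refine ⟨fun t _ => hypConst t, fun _ _ => Real.exp_pos _, ?_, ?_, ?_⟩
    · intro p t ht i
      rw [hd, isNested_div hs.ne'] at ht
      simp only [hside, div_mul_eq_mul_div, ← mul_div_assoc, div_le_div_iff_of_pos_right hs,
        div_lt_div_iff_of_pos_right hs]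
      refine ⟨hyperbolic_estimate ht i, fun h0 m hp => ?_⟩
      rw [hd, nondegenerate_div hs] at h0
      exact ⟨hyperbolic_estimate_left_strict ht h0 i,
        fun n => hyperbolic_estimate_right_strict ht h0 hp⟩
    · intro t ht _
      rw [hd, nondegenerate_div hs] at ht
      exact hypConst_lt_one ht
    · intro ε hε
      obtain ⟨δ, hδ, h⟩ := exists_lt_hypConst hε
      refine ⟨δ / Real.sqrt (-κ), div_pos hδ hs, fun t _ ht _ => h t fun j => ?_⟩
      have := ht j
      rwa [hside, div_lt_div_iff_of_pos_right hs] at this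
  · intro κ hκ
    have hs : 0 < Real.sqrt κ := Real.sqrt_pos.2 hκ
    have hd : sphDist κ = fun z w => sphAngle z w / Real.sqrt κ := rfl
    have hside : ∀ t i, side (sphDist κ) t i = side sphAngle t i / Real.sqrt κ := fun _ _ => rfl
    -- Height and diameter are fixed as functions of the initial triangle alone, so that the
    -- constant does not depend on the nested sequence.
    choose m r hmr using exists_capBound_explicit
    refine ⟨fun t _ => capConst (m t) (r t), fun _ _ => Real.exp_pos _, ?_, ?_, ?_⟩
    · intro p t hh ht i
      rw [hd, isNested_div hs.ne'] at ht
      obtain ⟨⟨u, hu⟩, hr, -⟩ := hmr (t 0) hh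
      simp only [hside, div_mul_eq_mul_div, ← mul_div_assoc, div_le_div_iff_of_pos_right hs,
        div_lt_div_iff_of_pos_right hs]
      refine ⟨hu.estimate ht i, fun h0 k hp => ?_⟩
      rw [hd, nondegenerate_div hs] at h0
      exact ⟨fun n => hu.estimate_left_strict ht hh h0 hp,
        hu.estimate_right_strict ht h0 (hr h0) i⟩
    · intro t hh ht _
      rw [hd, nondegenerate_div hs] at ht
      obtain ⟨⟨u, hu⟩, hr, -⟩ := hmr t hh
      exact one_lt_capConst hu.pos (hr ht)
    · intro ε hε
      obtain ⟨δ, hδ, hδ', h⟩ := exists_capConst_lt hε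
      refine ⟨δ / Real.sqrt κ, div_pos hδ hs, fun t hh _ ht _ => ?_⟩
      have ht' : ∀ j, side sphAngle t j < δ := fun j => by
        have := ht j
        rwa [hside, div_lt_div_iff_of_pos_right hs] at this
      obtain ⟨hm, hr⟩ := (hmr t hh).2.2 fun j => (ht' j).trans_le hδ'
      simp only [hm, hr]
      exact h t ht'
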